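/- Let $\mathbb{D}=\{z\in\mathbb{C}:|z|<1\}$ and $\alpha\in(0,2]$. For integers $k\ge 0$ and $t\in[0,1)$ put $$F_k(t)=F\Big(-\frac{\alpha}{2},\,k-\frac{\alpha}{2};\,k+1;\,t\Big),\qquad F(a,b;c;t)=\sum_{n=0}^{\infty}\frac{(a)_n(b)_n}{(c)_n}\frac{t^n}{n!},$$ where $(a)_0=1$ and $(a)_n=a(a+1)\cdots(a+n-1)$ for $n\ge 1$. A function $u:\mathbb{D}\to\mathbb{C}$ is called a real kernel $\alpha$-harmonic mapping if $$u(z)=\sum_{j=0}^{\infty}c_jF_j(|z|^2)z^j+\sum_{j=1}^{\infty}c_{-j}F_j(|z|^2)\bar z^{\,j},\qquad z\in\mathbb{D},$$ for complex numbers $c_j$ $(j\in\mathbb{Z})$ with $\limsup_{|j|\to\infty}|c_j|^{1/|j|}\le 1$. Theorem 4.3. Let $\alpha\in(0,2]$, let $k\ge 1$ be an integer, and let $c_{-k}$ be a real number with $|c_{-k}|<N$, where $$N=\frac{\alpha}{2\left(\dfrac{(k-\frac{\alpha}{2})\,\Gamma(k+1)\,\Gamma(2+\frac{\alpha}{2})}{\Gamma(k+1+\frac{\alpha}{2})}+k\right)}.$$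 Then the function $$u(z)=F_1(|z|^2)\,z+c_{-k}F_k(|z|^2)\,\bar z^{\,k},\qquad z\in\mathbb{D},$$ is a real kernel $\alpha$-harmonic mapping, it is sense-preserving in $\mathbb{D}$ (that is, $u$ is continuously differentiable in the real sense and $|u_z|>|u_{\bar z}|$ at every point of $\mathbb{D}$), and it is univalent (that is, injective) in $\mathbb{D}$. -/

import Mathlib

open Set Filter Topology
open scoped ComplexConjugate ENNReal

noncomputable section

/-- The function `F_k(t) = F(-α/2, k - α/2; k + 1; t)`, where `F` is the Gauss hypergeometric
function, given for `|t| < 1` by the hypergeometric series. -/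
def kernelF (α : ℝ) (k : ℕ) (t : ℝ) : ℝ :=
  ordinaryHypergeometric (-(α / 2)) ((k : ℝ) - α / 2) ((k : ℝ) + 1) t

/-- The building blocks of real kernel `α`-harmonic mappings: `F_k(|z|²) z ^ k` for `k ≥ 0` and
`F_{|k|}(|z|²) (conj z) ^ |k|` for `k < 0`. -/
def kernelMode (α : ℝ) (k : ℤ) (z : ℂ) : ℂ :=
  (kernelF α k.natAbs (‖z‖ ^ 2) : ℂ) * (if 0 ≤ k then z ^ k.natAbs else conj z ^ k.natAbs)

/-- A function `u` on the open unit disk is a real kernel `α`-harmonic mapping if it has an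
expansion `u(z) = ∑_{k ≥ 0} c_k F_k(|z|²) z^k + ∑_{k ≥ 1} c_{-k} F_k(|z|²) (conj z)^k`
with complex coefficients such that `limsup_{|k| → ∞} |c_k|^{1/|k|} ≤ 1`. -/
def IsRealKernelHarmonic (α : ℝ) (u : ℂ → ℂ) : Prop :=
  ∃ c : ℤ → ℂ,
    limsup (fun k : ℤ => ENNReal.ofReal (‖c k‖ ^ (1 / (k.natAbs : ℝ)))) cofinite ≤ 1 ∧
    ∀ z ∈ Metric.ball (0 : ℂ) 1, HasSum (fun k : ℤ => c k * kernelMode α k z) (u z)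

/-- The Wirtinger derivative `∂u/∂z = (u_x - i u_y) / 2`. -/
def wirtingerZ (u : ℂ → ℂ) (z : ℂ) : ℂ :=
  (fderiv ℝ u z 1 - Complex.I * fderiv ℝ u z Complex.I) / 2

/-- The Wirtinger derivative `∂u/∂(conj z) = (u_x + i u_y) / 2`. -/
def wirtingerZBar (u : ℂ → ℂ) (z : ℂ) : ℂ :=
  (fderiv ℝ u z 1 + Complex.I * fderiv ℝ u z Complex.I) / 2

/-- A function is sense-preserving on the open set `U` if it is continuously differentiable there
in the real sense and `|u_z| > |u_{conj z}|` on `U`; equivalently, its Jacobian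
`|u_z|² - |u_{conj z}|²` is positive on `U`. -/
def SensePreservingOn (u : ℂ → ℂ) (U : Set ℂ) : Prop :=
  ContDiffOn ℝ 1 u U ∧ ∀ z ∈ U, ‖wirtingerZBar u z‖ < ‖wirtingerZ u z‖

/-- The mapping `u(z) = F_1(|z|²) z + c F_k(|z|²) (conj z)^k`. -/
def twoTermMap (α : ℝ) (k : ℕ) (c : ℝ) (z : ℂ) : ℂ :=
  (kernelF α 1 (‖z‖ ^ 2) : ℂ) * z + (c : ℂ) * (kernelF α k (‖z‖ ^ 2) : ℂ) * conj z ^ k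

/-- The bound
`N = α / (2 ((k - α/2) Γ(k + 1) Γ(2 + α/2) / Γ(k + 1 + α/2) + k))`. -/
def coeffBound (α : ℝ) (k : ℕ) : ℝ :=
  α / (2 * (((k : ℝ) - α / 2) * Real.Gamma ((k : ℝ) + 1) * Real.Gamma (2 + α / 2)
    / Real.Gamma ((k : ℝ) + 1 + α / 2) + (k : ℝ)))

end

/-! Both sense-preservation and injectivity follow from `|u_{conj z}| < Re u_z`, the latter by
`injOn_of_norm_lt_re` on the convex disk. With `t = |z|²`, `F = F_1`, `G = F_k` and `F', G' ≤ 0`,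
the triangle inequality reduces this to `|c| k G |z|^(k-1) < F + 2tF'`, since the `G'` terms cancel
(`norm_lt_re_twoTermMap`). The right side is at least `(α/2) F` because `2tF' + (1 - α/2) F ≥ 0`
(`two_mul_deriv_kernelF_add_ge`). Finally `0 < G ≤ F`, and the coefficient bound gives `|c| k <
α/2`. -/

/-! ### Hypergeometric coefficients: size, sign, monotonicity in `k` -/

/-- The `n`-th coefficient of the hypergeometric series defining `kernelF α k`. -/
noncomputable def kernelCoeff (α : ℝ) (k n : ℕ) : ℝ :=
  ordinaryHypergeometricCoefficient (-(α / 2)) ((k : ℝ) - α / 2) ((k : ℝ) + 1) n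

theorem kernelCoeff_zero (α : ℝ) (k : ℕ) : kernelCoeff α k 0 = 1 := by
  simp [kernelCoeff, ordinaryHypergeometricCoefficient]

theorem kernelCoeff_succ (α : ℝ) (k n : ℕ) :
    kernelCoeff α k (n + 1) = kernelCoeff α k n *
      (((n : ℝ) - α / 2) / (n + 1) * (((k : ℝ) - α / 2 + n) / (k + 1 + n))) := by
  have h : (0 : ℝ) < (ascPochhammer ℝ n).eval ((k : ℝ) + 1) :=
    ascPochhammer_pos n _ (by positivity)
  simp only [kernelCoeff, ordinaryHypergeometricCoefficient, ascPochhammer_succ_eval,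
    Nat.factorial_succ, Nat.cast_mul, Nat.cast_add, Nat.cast_one]
  field_simp
  ring

theorem kernelF_eq_tsum (α : ℝ) (k : ℕ) (t : ℝ) :
    kernelF α k t = ∑' n, kernelCoeff α k n * t ^ n := by
  simp [kernelF, ordinaryHypergeometric_eq_tsum, kernelCoeff]

theorem abs_kernelCoeff_le_one {α : ℝ} (hα : α ∈ Ioc (0 : ℝ) 2) {k : ℕ} (hk : 1 ≤ k) (n : ℕ) :
    |kernelCoeff α k n| ≤ 1 := by
  obtain ⟨h0, h2⟩ := hα
  have hk' : (1 : ℝ) ≤ k := by exact_mod_cast hk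
  induction n with
  | zero => simp [kernelCoeff_zero]
  | succ n ih =>
    have hn : (0 : ℝ) ≤ n := n.cast_nonneg
    rw [kernelCoeff_succ, abs_mul, abs_mul]
    refine mul_le_one₀ ih (by positivity) (mul_le_one₀ ?_ (by positivity) ?_)
    · rw [abs_div, div_le_one (by positivity), abs_of_nonneg (by positivity : (0 : ℝ) ≤ n + 1),
        abs_le]
      constructor <;> linarith
    · rw [abs_div, div_le_one (by positivity),
        abs_of_nonneg (by positivity : (0 : ℝ) ≤ k + 1 + n), abs_le]
      constructor <;> linarith

theorem kernelCoeff_succ_nonpos {α : ℝ} (hα : α ∈ Ioc (0 : ℝ) 2) {k : ℕ} (hk : 1 ≤ k) (n : ℕ) :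
    kernelCoeff α k (n + 1) ≤ 0 := by
  obtain ⟨h0, h2⟩ := hα
  have hk' : (1 : ℝ) ≤ k := by exact_mod_cast hk
  have hq (n : ℕ) : 0 ≤ ((k : ℝ) - α / 2 + n) / (k + 1 + n) := by
    have hn : (0 : ℝ) ≤ n := n.cast_nonneg
    exact div_nonneg (by linarith) (by positivity)
  induction n with
  | zero =>
    rw [kernelCoeff_succ, kernelCoeff_zero, one_mul]
    exact mul_nonpos_of_nonpos_of_nonneg
      (div_nonpos_of_nonpos_of_nonneg (by push_cast; linarith) (by positivity)) (hq 0)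
  | succ n ih =>
    rw [kernelCoeff_succ]
    have hn : (0 : ℝ) ≤ n := n.cast_nonneg
    exact mul_nonpos_of_nonpos_of_nonneg ih
      (mul_nonneg (div_nonneg (by push_cast; linarith) (by positivity)) (hq _))

/-- The ratio factor `(k - α/2 + n)/(k + 1 + n)` increases with `k`, and it multiplies nonpositive
quantities. -/
theorem kernelCoeff_le_kernelCoeff_one {α : ℝ} (hα : α ∈ Ioc (0 : ℝ) 2) {k : ℕ} (hk : 1 ≤ k)
    (n : ℕ) : kernelCoeff α k n ≤ kernelCoeff α 1 n := by
  obtain ⟨h0, h2⟩ := id hα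
  have hk' : (1 : ℝ) ≤ k := by exact_mod_cast hk
  have hq (n : ℕ) : ((1 : ℕ) - α / 2 + n) / ((1 : ℕ) + 1 + n) ≤
      ((k : ℝ) - α / 2 + n) / (k + 1 + n) := by
    have hn : (0 : ℝ) ≤ n := n.cast_nonneg
    rw [div_le_div_iff₀ (by positivity) (by positivity)]
    push_cast
    nlinarith
  have hq1 (n : ℕ) : 0 ≤ ((1 : ℕ) - α / 2 + n) / ((1 : ℕ) + 1 + n) := by
    have hn : (0 : ℝ) ≤ n := n.cast_nonneg
    exact div_nonneg (by push_cast; linarith) (by positivity)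
  induction n with
  | zero => simp [kernelCoeff_zero]
  | succ n ih =>
    -- The factor `(n - α/2)/(n + 1)` is negative only at `n = 0`; afterwards the sign comes from
    -- the coefficient itself.
    rcases n with - | n
    · simp only [kernelCoeff_succ, kernelCoeff_zero, one_mul]
      exact mul_le_mul_of_nonpos_left (hq 0)
        (div_nonpos_of_nonpos_of_nonneg (by push_cast; linarith) (by positivity))
    · have hn : (0 : ℝ) ≤ n := n.cast_nonneg
      have hd : 0 ≤ (((n + 1 : ℕ) : ℝ) - α / 2) / ((n + 1 : ℕ) + 1) :=
        div_nonneg (by push_cast; linarith) (by positivity)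
      rw [kernelCoeff_succ α k, kernelCoeff_succ α 1]
      exact (mul_le_mul_of_nonpos_left (mul_le_mul_of_nonneg_left (hq _) hd)
        (kernelCoeff_succ_nonpos hα hk n)).trans
        (mul_le_mul_of_nonneg_right ih (mul_nonneg hd (hq1 _)))

/-- The telescoping identity behind `2 t F_k'(t) + (k - α / 2) F_k(t) ≥ 0`. -/
theorem sum_kernelCoeff_mul (α : ℝ) (k n : ℕ) :
    α / 2 * ∑ j ∈ Finset.range (n + 1), kernelCoeff α k j * (2 * j + (k - α / 2)) =
      -(kernelCoeff α k n * (n - α / 2) * (k - α / 2 + n)) := by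
  induction n with
  | zero => simp [kernelCoeff_zero]
  | succ n ih =>
    rw [Finset.sum_range_succ, mul_add, ih]
    have h : kernelCoeff α k (n + 1) * ((n + 1) * (k + 1 + n)) =
        kernelCoeff α k n * (n - α / 2) * (k - α / 2 + n) := by
      rw [kernelCoeff_succ]
      field_simp
    rw [← h]
    push_cast
    ring

theorem sum_kernelCoeff_mul_nonneg {α : ℝ} (hα : α ∈ Ioc (0 : ℝ) 2) {k : ℕ} (hk : 1 ≤ k)
    (n : ℕ) :
    0 ≤ ∑ j ∈ Finset.range n, kernelCoeff α k j * (2 * j + (k - α / 2)) := by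
  obtain ⟨h0, h2⟩ := id hα
  have hk' : (1 : ℝ) ≤ k := by exact_mod_cast hk
  rcases n with - | n
  · simp
  · refine nonneg_of_mul_nonneg_right (a := α / 2) ?_ (by positivity)
    have hn : (0 : ℝ) ≤ n := n.cast_nonneg
    rw [sum_kernelCoeff_mul, ← neg_mul]
    refine mul_nonneg ?_ (by linarith)
    -- At index 0 the coefficient is `1` and `n - α/2` is negative; later the signs are swapped,
    -- because `α/2 ≤ 1`.
    rcases n with - | n
    · rw [kernelCoeff_zero]; push_cast; linarith
    · rw [← neg_mul]
      refine mul_nonneg (neg_nonneg.2 (kernelCoeff_succ_nonpos hα hk n)) ?_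
      push_cast at hn ⊢
      linarith [(Nat.cast_nonneg n : (0 : ℝ) ≤ n)]

/-! ### Real power series with bounded coefficients -/

/-- A power series with nonnegative partial sums at `1` and nonpositive non-constant coefficients
is bounded below by `(1 - t) g 0` on `[0, 1]`. -/
theorem one_sub_mul_le_tsum {g : ℕ → ℝ} (hg : ∀ n, g (n + 1) ≤ 0)
    (hs : ∀ n, 0 ≤ ∑ j ∈ Finset.range n, g j) {t : ℝ} (h0 : 0 ≤ t) (h1 : t ≤ 1)
    (hsum : Summable fun n => g n * t ^ n) : (1 - t) * g 0 ≤ ∑' n, g n * t ^ n := by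
  refine ge_of_tendsto hsum.hasSum.tendsto_sum_nat (eventually_atTop.2 ⟨1, fun n hn => ?_⟩)
  obtain ⟨m, rfl⟩ := Nat.exists_eq_add_of_le' hn
  have h := hs (m + 1)
  rw [Finset.sum_range_succ'] at h ⊢
  have h' : t * ∑ j ∈ Finset.range m, g (j + 1) ≤
      ∑ j ∈ Finset.range m, g (j + 1) * t ^ (j + 1) := by
    rw [Finset.mul_sum]
    refine Finset.sum_le_sum fun j _ => ?_
    have := mul_le_mul_of_nonpos_left
      (mul_le_of_le_one_right h0 (pow_le_one₀ h0 h1 : t ^ j ≤ 1)) (hg j)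
    rw [pow_succ' t j, mul_comm t (g _)]
    exact this
  have := mul_nonneg h0 h
  rw [pow_zero, mul_one]
  linarith

theorem summable_mul_pow_of_abs_le_one {A : ℕ → ℝ} (hA : ∀ n, |A n| ≤ 1) {t : ℝ} (ht : |t| < 1) :
    Summable fun n => A n * t ^ n :=
  Summable.of_norm_bounded (summable_geometric_of_lt_one (abs_nonneg t) ht) fun n => by
    rw [Real.norm_eq_abs, abs_mul, abs_pow]
    exact mul_le_of_le_one_left (by positivity) (hA n)

theorem summable_natCast_mul_pow_of_abs_le_one {A : ℕ → ℝ} (hA : ∀ n, |A n| ≤ 1) {t : ℝ}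
    (ht : |t| < 1) : Summable fun n : ℕ => A n * n * t ^ n := by
  refine Summable.of_norm_bounded (summable_pow_mul_geometric_of_norm_lt_one 1
    (r := |t|) (by simpa using ht)) fun n => ?_
  rw [Real.norm_eq_abs, abs_mul, abs_pow, abs_mul, Nat.abs_cast, pow_one]
  exact mul_le_mul_of_nonneg_right (mul_le_of_le_one_left (by positivity) (hA n)) (by positivity)

theorem hasDerivAt_tsum_mul_pow {A : ℕ → ℝ} (hA : ∀ n, |A n| ≤ 1) {t : ℝ} (ht : |t| < 1) :
    HasDerivAt (fun x => ∑' n, A n * x ^ n) (∑' n : ℕ, A n * (n * t ^ (n - 1))) t := by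
  obtain ⟨r, htr, hr⟩ := exists_between ht
  have h0 : 0 ≤ r := (abs_nonneg t).trans htr.le
  -- Dominates the termwise derivatives uniformly on the ball of radius `r < 1`.
  have hu : Summable fun n : ℕ => (n : ℝ) * r ^ (n - 1) := by
    rw [← summable_nat_add_iff 1]
    have h := (summable_pow_mul_geometric_of_norm_lt_one 1 (r := r)
      (by rwa [Real.norm_of_nonneg h0])).add (summable_geometric_of_lt_one h0 hr)
    refine h.congr fun n => ?_
    push_cast
    ring
  refine hasDerivAt_tsum_of_isPreconnected (g := fun n x => A n * x ^ n)
    (g' := fun n x => A n * (n * x ^ (n - 1))) hu (t := Metric.ball 0 r) (y₀ := 0)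
    Metric.isOpen_ball (convex_ball _ _).isPreconnected
    (fun n y _ => (hasDerivAt_pow n y).const_mul _) (fun n y hy => ?_) ?_ ?_ ?_
  · rw [mem_ball_zero_iff, Real.norm_eq_abs] at hy
    rw [Real.norm_eq_abs, abs_mul, abs_mul, abs_pow, Nat.abs_cast]
    refine (mul_le_of_le_one_left (by positivity) (hA n)).trans ?_
    gcongr
  · exact Metric.mem_ball_self ((abs_nonneg t).trans_lt htr)
  · exact summable_mul_pow_of_abs_le_one hA (by simp)
  · simpa using htr

theorem contDiffOn_tsum_mul_pow {A : ℕ → ℝ} (hA : ∀ n, |A n| ≤ 1) {m : WithTop ℕ∞} :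
    ContDiffOn ℝ m (fun x => ∑' n, A n * x ^ n) (Metric.ball 0 1) := by
  set p := FormalMultilinearSeries.ofScalars ℝ A
  have hr : (1 : ℝ≥0∞) ≤ p.radius := by
    have := p.le_radius_of_bound 1 (r := 1) fun n => by
      rw [FormalMultilinearSeries.ofScalars_norm]
      simpa using hA n
    simpa using this
  have hp : p.sum = fun x => ∑' n, A n * x ^ n := by
    funext x
    exact FormalMultilinearSeries.ofScalars_sum_eq A x
  have h := (p.hasFPowerSeriesOnBall (zero_lt_one.trans_le hr)).analyticOnNhd
  rw [hp] at h
  refine (h.mono ?_).contDiffOn (Metric.isOpen_ball.uniqueDiffOn)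
  rw [← Metric.eball_ofReal, ENNReal.ofReal_one]
  exact Metric.eball_subset_eball hr

/-! ### Regularity and inequalities for `F_k` -/

theorem contDiffOn_kernelF {α : ℝ} (hα : α ∈ Ioc (0 : ℝ) 2) {k : ℕ} (hk : 1 ≤ k)
    {m : WithTop ℕ∞} : ContDiffOn ℝ m (kernelF α k) (Metric.ball 0 1) := by
  rw [funext (kernelF_eq_tsum α k)]
  exact contDiffOn_tsum_mul_pow (abs_kernelCoeff_le_one hα hk)

theorem differentiableAt_kernelF {α : ℝ} (hα : α ∈ Ioc (0 : ℝ) 2) {k : ℕ} (hk : 1 ≤ k)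
    {t : ℝ} (ht : |t| < 1) : DifferentiableAt ℝ (kernelF α k) t := by
  rw [funext (kernelF_eq_tsum α k)]
  exact (hasDerivAt_tsum_mul_pow (abs_kernelCoeff_le_one hα hk) ht).differentiableAt

theorem deriv_kernelF {α : ℝ} (hα : α ∈ Ioc (0 : ℝ) 2) {k : ℕ} (hk : 1 ≤ k)
    {t : ℝ} (ht : |t| < 1) :
    deriv (kernelF α k) t = ∑' n : ℕ, kernelCoeff α k n * (n * t ^ (n - 1)) := by
  rw [funext (kernelF_eq_tsum α k)]
  exact (hasDerivAt_tsum_mul_pow (abs_kernelCoeff_le_one hα hk) ht).deriv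

theorem deriv_kernelF_nonpos {α : ℝ} (hα : α ∈ Ioc (0 : ℝ) 2) {k : ℕ} (hk : 1 ≤ k)
    {t : ℝ} (h0 : 0 ≤ t) (h1 : t < 1) : deriv (kernelF α k) t ≤ 0 := by
  rw [deriv_kernelF hα hk (by rwa [abs_of_nonneg h0])]
  refine tsum_nonpos fun n => ?_
  rcases n with - | n
  · simp
  · exact mul_nonpos_of_nonpos_of_nonneg (kernelCoeff_succ_nonpos hα hk n) (by positivity)

theorem mul_deriv_kernelF {α : ℝ} (hα : α ∈ Ioc (0 : ℝ) 2) {k : ℕ} (hk : 1 ≤ k)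
    {t : ℝ} (ht : |t| < 1) :
    t * deriv (kernelF α k) t = ∑' n : ℕ, kernelCoeff α k n * n * t ^ n := by
  rw [deriv_kernelF hα hk ht, ← tsum_mul_left]
  refine tsum_congr fun n => ?_
  rcases n with - | n
  · simp
  · rw [Nat.add_sub_cancel, pow_succ]
    ring

/-- The right side is the power series with coefficients `kernelCoeff α k n * (2n + k - α/2)`, whose
partial sums at `1` telescope to nonnegative values. -/
theorem two_mul_deriv_kernelF_add_ge {α : ℝ} (hα : α ∈ Ioc (0 : ℝ) 2) {k : ℕ} (hk : 1 ≤ k)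
    {t : ℝ} (h0 : 0 ≤ t) (h1 : t < 1) :
    (1 - t) * (k - α / 2) ≤ 2 * (t * deriv (kernelF α k) t) + (k - α / 2) * kernelF α k t := by
  have hk' : (1 : ℝ) ≤ k := by exact_mod_cast hk
  have ht : |t| < 1 := by rwa [abs_of_nonneg h0]
  have hA := abs_kernelCoeff_le_one hα hk
  have h := ((summable_natCast_mul_pow_of_abs_le_one hA ht).hasSum.mul_left 2).add
    ((summable_mul_pow_of_abs_le_one hA ht).hasSum.mul_left ((k : ℝ) - α / 2))
  rw [← mul_deriv_kernelF hα hk ht, ← kernelF_eq_tsum] at h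
  have h' : HasSum (fun n : ℕ => kernelCoeff α k n * (2 * n + (k - α / 2)) * t ^ n) _ :=
    h.congr_fun fun n => by ring
  have := one_sub_mul_le_tsum (fun n => ?_) (sum_kernelCoeff_mul_nonneg hα hk) h0 h1.le h'.summable
  · rw [h'.tsum_eq] at this
    simpa [kernelCoeff_zero] using this
  · refine mul_nonpos_of_nonpos_of_nonneg (kernelCoeff_succ_nonpos hα hk n) ?_
    have : (0 : ℝ) ≤ (n + 1 : ℕ) := by positivity
    linarith [hα.2]

theorem kernelF_pos {α : ℝ} (hα : α ∈ Ioc (0 : ℝ) 2) {k : ℕ} (hk : 1 ≤ k)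
    {t : ℝ} (h0 : 0 ≤ t) (h1 : t < 1) : 0 < kernelF α k t := by
  have hk' : (1 : ℝ) ≤ k := by exact_mod_cast hk
  have hd : 0 ≤ (k : ℝ) - α / 2 := by linarith [hα.2]
  -- Equality means `k = 1`, `α = 2`: the lower bound degenerates, but `F_k` is constantly `1`.
  rcases hd.eq_or_lt with hd | hd
  · have hA : ∀ n, n ≠ 0 → kernelCoeff α k n = 0 := by
      intro n hn
      obtain ⟨m, rfl⟩ := Nat.exists_eq_succ_of_ne_zero hn
      clear hn
      induction m with
      | zero => simp [kernelCoeff_succ, ← hd]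
      | succ m ih => rw [Nat.succ_eq_add_one, kernelCoeff_succ, ih, zero_mul]
    rw [kernelF_eq_tsum, tsum_eq_single 0 fun n hn => by rw [hA n hn, zero_mul]]
    simp [kernelCoeff_zero]
  · have h := two_mul_deriv_kernelF_add_ge hα hk h0 h1
    have h' := mul_nonpos_of_nonneg_of_nonpos h0 (deriv_kernelF_nonpos hα hk h0 h1)
    have h'' := mul_pos (sub_pos.2 h1) hd
    exact pos_of_mul_pos_right (b := kernelF α k t) (by linarith) hd.le

theorem kernelF_le_kernelF_one {α : ℝ} (hα : α ∈ Ioc (0 : ℝ) 2) {k : ℕ} (hk : 1 ≤ k)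
    {t : ℝ} (h0 : 0 ≤ t) (h1 : t < 1) : kernelF α k t ≤ kernelF α 1 t := by
  have ht : |t| < 1 := by rwa [abs_of_nonneg h0]
  rw [kernelF_eq_tsum, kernelF_eq_tsum]
  exact (summable_mul_pow_of_abs_le_one (abs_kernelCoeff_le_one hα hk) ht).tsum_le_tsum
    (fun n => mul_le_mul_of_nonneg_right (kernelCoeff_le_kernelCoeff_one hα hk n) (by positivity))
    (summable_mul_pow_of_abs_le_one (abs_kernelCoeff_le_one hα le_rfl) ht)

/-- The Gamma quotient in the bound is nonnegative, so dropping it only enlarges the bound, to `α /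
(2k)`. -/
theorem abs_mul_lt_of_lt_coeffBound {α : ℝ} (hα : α ∈ Ioc (0 : ℝ) 2) {k : ℕ} (hk : 1 ≤ k)
    {c : ℝ} (hc : |c| < coeffBound α k) : |c| * k < α / 2 := by
  obtain ⟨h0, h2⟩ := hα
  have hk' : (1 : ℝ) ≤ k := by exact_mod_cast hk
  have hR : 0 ≤ ((k : ℝ) - α / 2) * Real.Gamma ((k : ℝ) + 1) * Real.Gamma (2 + α / 2)
      / Real.Gamma ((k : ℝ) + 1 + α / 2) :=
    div_nonneg (mul_nonneg (mul_nonneg (by linarith) (Real.Gamma_pos_of_pos (by positivity)).le)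
      (Real.Gamma_pos_of_pos (by positivity)).le) (Real.Gamma_pos_of_pos (by positivity)).le
  rw [← lt_div_iff₀ (by positivity)]
  refine hc.trans_le ?_
  rw [coeffBound, ← div_div]
  gcongr
  linarith

/-! ### Wirtinger calculus and the injectivity criterion -/

/-- The real-linear map `h ↦ P h + Q (conj h)`. -/
noncomputable def wirtingerCLM (P Q : ℂ) : ℂ →L[ℝ] ℂ :=
  P • ContinuousLinearMap.id ℝ ℂ + Q • (Complex.conjCLE : ℂ →L[ℝ] ℂ)

@[simp]
theorem wirtingerCLM_apply (P Q h : ℂ) : wirtingerCLM P Q h = P * h + Q * conj h := by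
  simp [wirtingerCLM]

theorem wirtingerZ_eq {u : ℂ → ℂ} {P Q z : ℂ} (h : HasFDerivAt u (wirtingerCLM P Q) z) :
    wirtingerZ u z = P := by
  rw [wirtingerZ, h.fderiv]
  simp only [wirtingerCLM_apply, map_one, Complex.conj_I]
  linear_combination ((Q - P) / 2) * Complex.I_sq

theorem wirtingerZBar_eq {u : ℂ → ℂ} {P Q z : ℂ} (h : HasFDerivAt u (wirtingerCLM P Q) z) :
    wirtingerZBar u z = Q := by
  rw [wirtingerZBar, h.fderiv]
  simp only [wirtingerCLM_apply, map_one, Complex.conj_I]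
  linear_combination ((P - Q) / 2) * Complex.I_sq

/-- A Noshiro–Warschawski type criterion: a mapping of a convex set with
`|u_{conj z}| < Re u_z` is injective. -/
theorem injOn_of_norm_lt_re {u P Q : ℂ → ℂ} {s : Set ℂ} (hs : Convex ℝ s)
    (hu : ∀ z ∈ s, HasFDerivAt u (wirtingerCLM (P z) (Q z)) z)
    (hPQ : ∀ z ∈ s, ‖Q z‖ < (P z).re) : InjOn u s := by
  intro z hz w hw huv
  by_contra hne
  set d := w - z with hd
  have hd0 : d ≠ 0 := sub_ne_zero.2 (Ne.symm hne)
  have hmem : ∀ x ∈ Icc (0 : ℝ) 1, z + x • d ∈ s := fun x hx => hs.add_smul_sub_mem hz hw hx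
  -- If `u z = u w`, this function has equal endpoint values, so Rolle gives a zero of a derivative
  -- that is at least `|d|² (Re P - |Q|) > 0`.
  have hder : ∀ x ∈ Icc (0 : ℝ) 1, HasDerivAt (fun x : ℝ => (conj d * u (z + x • d)).re)
      (conj d * (P (z + x • d) * d + Q (z + x • d) * conj d)).re x := by
    intro x hx
    have h1 : HasDerivAt (fun x : ℝ => z + x • d) d x := by
      simpa using ((hasDerivAt_id x).smul_const d).const_add z
    have h2 := (hu _ (hmem x hx)).comp_hasDerivAt x h1
    rw [wirtingerCLM_apply] at h2
    exact Complex.reCLM.hasFDerivAt.comp_hasDerivAt x (h2.const_mul (conj d))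
  obtain ⟨x, hx, hx0⟩ := exists_hasDerivAt_eq_zero one_pos
    (fun x hx => (hder x hx).continuousAt.continuousWithinAt) (by simp [hd, huv])
    (fun x hx => hder x (Ioo_subset_Icc_self hx))
  have hlt := hPQ _ (hmem x (Ioo_subset_Icc_self hx))
  set p := P (z + x • d)
  set q := Q (z + x • d)
  have h3 : (conj d * (p * d + q * conj d)).re =
      ‖d‖ ^ 2 * p.re + (conj d * (q * conj d)).re := by
    rw [mul_add, Complex.add_re, ← Complex.re_ofReal_mul, Complex.ofReal_pow,
      ← Complex.conj_mul' d]
    congr 2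
    ring
  have h4 : -(‖d‖ ^ 2 * ‖q‖) ≤ (conj d * (q * conj d)).re := by
    have h := neg_le_of_abs_le (Complex.abs_re_le_norm (conj d * (q * conj d)))
    rw [norm_mul, norm_mul, Complex.norm_conj] at h
    linarith
  have h5 : 0 < ‖d‖ ^ 2 := by positivity
  nlinarith [mul_lt_mul_of_pos_left hlt h5]

theorem norm_sq_lt_one {z : ℂ} (hz : z ∈ Metric.ball (0 : ℂ) 1) : ‖z‖ ^ 2 < 1 := by
  rw [mem_ball_zero_iff] at hz
  exact pow_lt_one₀ (norm_nonneg z) hz two_ne_zero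

theorem hasFDerivAt_comp_norm_sq {f : ℝ → ℝ} {f' : ℝ} {z : ℂ} (hf : HasDerivAt f f' (‖z‖ ^ 2)) :
    HasFDerivAt (fun w : ℂ => (f (‖w‖ ^ 2) : ℂ)) (wirtingerCLM (f' * conj z) (f' * z)) z := by
  have h := Complex.ofRealCLM.hasFDerivAt.comp z
    (hf.comp_hasFDerivAt z (hasStrictFDerivAt_norm_sq z).hasFDerivAt)
  refine h.congr_fderiv ?_
  ext v
  have : (v * conj z + z * conj v) = ((2 * (v * conj z).re : ℝ) : ℂ) := by
    rw [← Complex.add_conj]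
    simp [mul_comm]
  have h2 : wirtingerCLM (f' * conj z) (f' * z) v = f' * (v * conj z + z * conj v) := by
    rw [wirtingerCLM_apply]; ring
  rw [h2, this]
  simp [Complex.inner]
  ring

theorem hasFDerivAt_conj_pow (n : ℕ) (z : ℂ) :
    HasFDerivAt (fun w : ℂ => conj w ^ n) (wirtingerCLM 0 (n * conj z ^ (n - 1))) z := by
  have h := (((hasDerivAt_pow n (conj z)).hasFDerivAt.restrictScalars ℝ).comp z
    (Complex.conjCLE : ℂ →L[ℝ] ℂ).hasFDerivAt)
  refine h.congr_fderiv ?_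
  ext v
  simp [mul_comm]

/-! ### The two-term map -/

theorem hasFDerivAt_twoTermMap {α : ℝ} (hα : α ∈ Ioc (0 : ℝ) 2) (j : ℕ) (c : ℝ) {z : ℂ}
    (hz : z ∈ Metric.ball (0 : ℂ) 1) :
    HasFDerivAt (twoTermMap α (j + 1) c) (wirtingerCLM
      ((kernelF α 1 (‖z‖ ^ 2) + ‖z‖ ^ 2 * deriv (kernelF α 1) (‖z‖ ^ 2) : ℝ) +
        (c * deriv (kernelF α (j + 1)) (‖z‖ ^ 2) : ℝ) * conj z ^ (j + 2))
      (deriv (kernelF α 1) (‖z‖ ^ 2) * z ^ 2 +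
        (c * (‖z‖ ^ 2 * deriv (kernelF α (j + 1)) (‖z‖ ^ 2) +
          (j + 1) * kernelF α (j + 1) (‖z‖ ^ 2)) : ℝ) * conj z ^ j)) z := by
  have ht : |‖z‖ ^ 2| < 1 := by rw [abs_of_nonneg (by positivity)]; exact norm_sq_lt_one hz
  have h1 := (hasFDerivAt_comp_norm_sq
    (differentiableAt_kernelF hα le_rfl ht).hasDerivAt).mul (hasFDerivAt_id (𝕜 := ℝ) z)
  have h2 := ((hasFDerivAt_comp_norm_sq (differentiableAt_kernelF hα (Nat.le_add_left 1 j)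
    ht).hasDerivAt).const_mul (c : ℂ)).mul (hasFDerivAt_conj_pow (j + 1) z)
  refine (h1.add h2).congr_fderiv ?_
  have hzz : ((‖z‖ : ℂ)) ^ 2 = conj z * z := (Complex.conj_mul' z).symm
  ext v
  simp
  rw [hzz]
  ring

theorem norm_lt_re_twoTermMap {α : ℝ} (hα : α ∈ Ioc (0 : ℝ) 2) (j : ℕ) {c : ℝ}
    (hc : |c| * (j + 1 : ℕ) < α / 2) {z : ℂ} (hz : z ∈ Metric.ball (0 : ℂ) 1) :
    ‖(deriv (kernelF α 1) (‖z‖ ^ 2) * z ^ 2 +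
        (c * (‖z‖ ^ 2 * deriv (kernelF α (j + 1)) (‖z‖ ^ 2) +
          (j + 1) * kernelF α (j + 1) (‖z‖ ^ 2)) : ℝ) * conj z ^ j : ℂ)‖ <
    ((kernelF α 1 (‖z‖ ^ 2) + ‖z‖ ^ 2 * deriv (kernelF α 1) (‖z‖ ^ 2) : ℝ) +
        (c * deriv (kernelF α (j + 1)) (‖z‖ ^ 2) : ℝ) * conj z ^ (j + 2) : ℂ).re := by
  have hj : 1 ≤ j + 1 := Nat.le_add_left 1 j
  have h0 : 0 ≤ ‖z‖ ^ 2 := by positivity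
  have h1 := norm_sq_lt_one hz
  have hr : ‖z‖ ≤ 1 := by rw [mem_ball_zero_iff] at hz; exact hz.le
  have d1 := deriv_kernelF_nonpos hα le_rfl h0 h1
  have dk := deriv_kernelF_nonpos hα hj h0 h1
  have g1 := two_mul_deriv_kernelF_add_ge hα le_rfl h0 h1
  have gk := two_mul_deriv_kernelF_add_ge hα hj h0 h1
  have p1 := kernelF_pos hα le_rfl h0 h1
  have pk := kernelF_pos hα hj h0 h1
  have hle := kernelF_le_kernelF_one hα hj h0 h1
  have hn1 : ‖(deriv (kernelF α 1) (‖z‖ ^ 2) * z ^ 2 : ℂ)‖ =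
      -(‖z‖ ^ 2 * deriv (kernelF α 1) (‖z‖ ^ 2)) := by
    rw [norm_mul, norm_pow, Complex.norm_real, Real.norm_of_nonpos d1]
    ring
  have hn2 (b : ℝ) (n : ℕ) : ‖((b : ℂ) * conj z ^ n : ℂ)‖ = |b| * ‖z‖ ^ n := by
    rw [norm_mul, norm_pow, Complex.norm_real, Complex.norm_conj, Real.norm_eq_abs]
  set t := ‖z‖ ^ 2 with htdef
  set F := kernelF α 1 t
  set F' := deriv (kernelF α 1) t
  set G := kernelF α (j + 1) t
  set G' := deriv (kernelF α (j + 1)) t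
  have hα0 := hα.1
  have hα2 := hα.2
  have hj0 : (0 : ℝ) ≤ j := j.cast_nonneg
  push_cast at g1 gk hc
  have g1' : 0 ≤ 2 * (t * F') + (1 - α / 2) * F :=
    (mul_nonneg (by linarith) (by linarith)).trans g1
  have gk' : 0 ≤ 2 * (t * G') + ((j : ℝ) + 1 - α / 2) * G :=
    (mul_nonneg (by linarith) (by linarith)).trans gk
  have hpos : 0 ≤ t * G' + (j + 1) * G := by nlinarith
  have hQ := norm_add_le ((F' : ℂ) * z ^ 2) ((c * (t * G' + (j + 1) * G) : ℝ) * conj z ^ j)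
  rw [hn1, hn2, abs_mul, abs_of_nonneg hpos] at hQ
  have hP := neg_le_of_abs_le (Complex.abs_re_le_norm ((c * G' : ℝ) * conj z ^ (j + 2)))
  rw [hn2, abs_mul, abs_of_nonpos dk] at hP
  refine hQ.trans_lt ?_
  rw [Complex.add_re, Complex.ofReal_re]
  have e1 : ‖z‖ ^ (j + 2) = ‖z‖ ^ j * t := by rw [pow_add]
  rw [e1] at hP
  have e2 : |c| * (j + 1) * G * ‖z‖ ^ j ≤ |c| * (j + 1) * G :=
    mul_le_of_le_one_right (by positivity) (pow_le_one₀ (norm_nonneg z) hr)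
  have e3 : |c| * (j + 1) * G < α / 2 * G := mul_lt_mul_of_pos_right hc pk
  have e4 : α / 2 * G ≤ α / 2 * F := mul_le_mul_of_nonneg_left hle (by positivity)
  -- The terms `|c| t G' |z|^j` from `hQ` and `hP` cancel exactly, leaving `|c| (j + 1) G |z|^j < F
  -- + 2tF'`.
  linarith

theorem contDiffOn_twoTermMap {α : ℝ} (hα : α ∈ Ioc (0 : ℝ) 2) {k : ℕ} (hk : 1 ≤ k) (c : ℝ) :
    ContDiffOn ℝ 1 (twoTermMap α k c) (Metric.ball (0 : ℂ) 1) := by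
  have hsq : ContDiffOn ℝ 1 (fun z : ℂ => ‖z‖ ^ 2) (Metric.ball (0 : ℂ) 1) :=
    (contDiff_norm_sq ℝ).contDiffOn
  have hmaps : MapsTo (fun z : ℂ => ‖z‖ ^ 2) (Metric.ball (0 : ℂ) 1) (Metric.ball (0 : ℝ) 1) := by
    intro z hz
    rw [mem_ball_zero_iff, Real.norm_of_nonneg (by positivity)]
    exact norm_sq_lt_one hz
  have hF {m : ℕ} (hm : 1 ≤ m) :
      ContDiffOn ℝ 1 (fun z : ℂ => (kernelF α m (‖z‖ ^ 2) : ℂ)) (Metric.ball (0 : ℂ) 1) :=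
    Complex.ofRealCLM.contDiff.comp_contDiffOn ((contDiffOn_kernelF hα hm).comp hsq hmaps)
  exact ((hF le_rfl).mul contDiffOn_id).add ((contDiffOn_const.mul (hF hk)).mul
    ((Complex.conjCLE : ℂ →L[ℝ] ℂ).contDiff.contDiffOn.pow k))

theorem isRealKernelHarmonic_twoTermMap (α : ℝ) {k : ℕ} (hk : 1 ≤ k) (c : ℝ) :
    IsRealKernelHarmonic α (twoTermMap α k c) := by
  have hne : (1 : ℤ) ≠ -(k : ℤ) := by omega
  let b : ℤ → ℂ := fun j => if j = 1 then 1 else if j = -(k : ℤ) then (c : ℂ) else 0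
  refine ⟨b, ?_, fun z _ => ?_⟩
  · refine limsup_le_of_le (h := ?_)
    -- Index `0` is excluded too: there `1 / 0 = 0`, and `0 ^ 0 = 1` rather than `0`.
    filter_upwards [(Set.toFinite {0, 1, -(k : ℤ)}).compl_mem_cofinite] with j hj
    simp only [mem_compl_iff, mem_insert_iff, mem_singleton_iff, not_or] at hj
    have hb : b j = 0 := by simp [b, hj.2.1, hj.2.2]
    have hj0 : (1 / (j.natAbs : ℝ)) ≠ 0 := by simpa using hj.1
    rw [hb, norm_zero, Real.zero_rpow hj0]
    simp
  · have h := hasSum_sum_of_ne_finset_zero (L := .unconditional ℤ) (f := fun j : ℤ => b j * kernelMode α j z)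
      (s := {1, -(k : ℤ)}) fun j hj => by
        simp only [Finset.mem_insert, Finset.mem_singleton, not_or] at hj
        simp [b, hj.1, hj.2]
    rw [Finset.sum_pair hne] at h
    convert! h using 1
    have hk0 : ¬ (0 : ℤ) ≤ -(k : ℤ) := by omega
    simp [b, kernelMode, twoTermMap, hne.symm, show k ≠ 0 by omega, mul_assoc]

theorem theorem4p3 (α : ℝ) (hα : α ∈ Set.Ioc (0 : ℝ) 2) (k : ℕ) (hk : 1 ≤ k)
    (c : ℝ) (hc : |c| < coeffBound α k) :
    IsRealKernelHarmonic α (twoTermMap α k c) ∧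
    SensePreservingOn (twoTermMap α k c) (Metric.ball (0 : ℂ) 1) ∧
    Set.InjOn (twoTermMap α k c) (Metric.ball (0 : ℂ) 1) := by
  refine ⟨isRealKernelHarmonic_twoTermMap α hk c, ⟨contDiffOn_twoTermMap hα hk c, ?_⟩, ?_⟩ <;>
    have hc' := abs_mul_lt_of_lt_coeffBound hα hk hc <;>
    obtain ⟨j, rfl⟩ := Nat.exists_eq_add_of_le' hk
  · intro z hz
    have hu := hasFDerivAt_twoTermMap hα j c hz
    rw [wirtingerZBar_eq hu, wirtingerZ_eq hu]
    exact (norm_lt_re_twoTermMap hα j hc' hz).trans_le (Complex.re_le_norm _)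
  · exact injOn_of_norm_lt_re (convex_ball _ _) (fun z hz => hasFDerivAt_twoTermMap hα j c hz)
      fun z hz => norm_lt_re_twoTermMap hα j hc' hz
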